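/- Let $m\ge n\ge 1$ be integers and let $A$ be a random matrix with values in $\mathbb{R}^{m\times n}$ such that (i) there is a constant $C$ with $\mathbb{P}[\|A\|_F > C]=0$, where $\|\cdot\|_F$ is the Frobenius norm, and (ii) the distribution of $A$ has a probability density function with respect to Lebesgue measure on $\mathbb{R}^{m\times n}\cong\mathbb{R}^{mn}$, and this density is (essentially) bounded. Then $A^{T}A$ is almost surely invertible, and for every real number $p<\frac{m-n+1}{2}$ the random matrix $(A^{T}A)^{-1}$ has a finite $p$-th moment, that is, $$\mathbb{E}\left[\left\|(A^{T}A)^{-1}\right\|_F^{\,p}\right]<\infty .$$ (Since all norms on $\mathbb{R}^{n\times n}$ are equivalent, the choice of the norm in the last expression is immaterial.) -/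

import Mathlib

open MeasureTheory ProbabilityTheory
open scoped ENNReal Matrix

/-- The space of real `m × n` matrices, identified with `ℝ^(m × n)` through the entries, carries
the product (Borel) sigma-algebra and the Lebesgue measure: `volume` is the product of `m * n`
copies of Lebesgue measure on `ℝ`, one for each entry. -/
noncomputable instance matrixMeasureSpace (m n : ℕ) :
    MeasureSpace (Matrix (Fin m) (Fin n) ℝ) :=
  inferInstanceAs (MeasureSpace (Fin m → Fin n → ℝ))

/-- The Frobenius norm `(∑ i, ∑ j, (M i j)²)^(1/2)`: Mathlib's `‖M‖` for the Frobenius structure. -/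
noncomputable def frobNorm {m n : ℕ} (M : Matrix (Fin m) (Fin n) ℝ) : ℝ :=
  letI : NormedAddCommGroup (Matrix (Fin m) (Fin n) ℝ) := Matrix.frobeniusNormedAddCommGroup
  ‖M‖

/-- A random matrix `X` has a finite moment of order `p ∈ ℝ`: `E[‖X‖_F ^ p] < ∞`. All norms on a
space of matrices are equivalent, so the choice of the norm is immaterial. -/
def HasFiniteMoment {Ω : Type*} [MeasurableSpace Ω] {m n : ℕ}
    (X : Ω → Matrix (Fin m) (Fin n) ℝ) (p : ℝ) (P : Measure Ω) : Prop :=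
  Integrable (fun ω => frobNorm (X ω) ^ p) P

/-! For `p > 0`, boundedness of the density and of `A` reduces the claim to a Lebesgue integral over
a cube, and the norm of the positive semidefinite `G⁻¹`, `G = Aᵀ * A`, is at most its trace. If a
unit vector `u` is orthogonal to all columns but the `j`-th column `x`, then `(G⁻¹) j j * ⟨u, x⟩ ^ 2
≤ 1` (`gram_inv_diag_mul_sq_le_one`). There are `d = m - n + 1` orthonormal such vectors; the
geometric mean of their bounds gives `(G⁻¹) j j ^ p ≤ ∏ |⟨u_i, x⟩| ^ (-2p/d)`. Each exponent exceeds
`-1` exactly when `p < d / 2`, so in rotated coordinates the integral over `x` is bounded uniformly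
in the other columns.

For `p ≤ 0` it suffices that `‖G⁻¹‖` is bounded away from zero. -/

/-! ### Negative powers of orthonormal coordinates. -/

theorem lintegral_pi_prod_lt_top {ι α : Type*} [Fintype ι] [MeasurableSpace α] {μ : Measure α}
    [SigmaFinite μ] {g : α → ℝ≥0∞} (hg : Measurable g) (hμ : ∫⁻ y, g y ∂μ < ∞) :
    ∫⁻ y : ι → α, ∏ i, g (y i) ∂(Measure.pi fun _ => μ) < ∞ := by
  have h1 : Integrable (fun y => (g y).toReal) μ :=
    integrable_toReal_of_lintegral_ne_top hg.aemeasurable hμ.ne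
  have h2 : Integrable (fun y : ι → α => ∏ i, (g (y i)).toReal) (Measure.pi fun _ => μ) :=
    Integrable.fintype_prod (f := fun _ y => (g y).toReal) fun _ => h1
  have h3 : ∀ᵐ y : ι → α ∂(Measure.pi fun _ => μ), ∀ i, g (y i) < ∞ :=
    Filter.eventually_all.2 fun i =>
      (Measure.tendsto_eval_ae_ae (μ := fun _ : ι => μ) (i := i)).eventually
        (ae_lt_top hg hμ.ne)
  rw [lintegral_congr_ae (g := fun y => ENNReal.ofReal (∏ i, (g (y i)).toReal))]
  · exact h2.lintegral_lt_top
  · filter_upwards [h3] with y hy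
    rw [ENNReal.ofReal_prod_of_nonneg fun _ _ => ENNReal.toReal_nonneg]
    exact Finset.prod_congr rfl fun i _ => (ENNReal.ofReal_toReal (hy i).ne).symm

theorem lintegral_Icc_one_add_enorm_rpow_lt_top {a : ℝ} (ha : a < 1) (R : ℝ) :
    ∫⁻ y : ℝ in Set.Icc (-R) R, (1 + ‖y‖ₑ ^ (-a)) < ∞ := by
  rw [lintegral_add_left measurable_const]
  refine ENNReal.add_lt_top.2 ⟨by simp, ?_⟩
  have h : ∫⁻ y : ℝ in Set.Ioc 0 R, ENNReal.ofReal (y ^ (-a)) < ∞ := by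
    rcases le_total R 0 with hR | hR
    · simp [Set.Ioc_eq_empty_of_le hR]
    · have := (intervalIntegrable_iff_integrableOn_Ioc_of_le hR).1
        (intervalIntegral.intervalIntegrable_rpow' (a := 0) (b := R) (r := -a) (by linarith))
      exact this.lintegral_lt_top
  have h' : ∫⁻ y : ℝ in Set.Ioc 0 R, ‖y‖ₑ ^ (-a) < ∞ := by
    rwa [setLIntegral_congr_fun measurableSet_Ioc
      (g := fun y => ENNReal.ofReal (y ^ (-a)))]
    intro y hy
    simp only
    rw [← ENNReal.ofReal_rpow_of_pos hy.1, Real.enorm_of_nonneg hy.1.le]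
  have h'' : ∫⁻ y : ℝ in Set.Ico (-R) 0, ‖y‖ₑ ^ (-a) < ∞ := by
    have := (Measure.measurePreserving_neg (volume : Measure ℝ)).setLIntegral_comp_preimage
      (s := Set.Ioc 0 R) measurableSet_Ioc (f := fun y => ‖y‖ₑ ^ (-a)) (by fun_prop)
    have e : (Neg.neg ⁻¹' Set.Ioc 0 R : Set ℝ) = Set.Ico (-R) 0 := by
      ext x; simp
    rw [e] at this
    simp only [enorm_neg] at this
    rwa [this]
  have hsub : (Set.Icc (-R) R : Set ℝ) ⊆ Set.Ico (-R) 0 ∪ {0} ∪ Set.Ioc 0 R := by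
    intro x hx
    rcases lt_trichotomy x 0 with h | h | h
    · exact Or.inl (Or.inl ⟨hx.1, h⟩)
    · exact Or.inl (Or.inr h)
    · exact Or.inr ⟨h, hx.2⟩
  calc ∫⁻ y : ℝ in Set.Icc (-R) R, ‖y‖ₑ ^ (-a)
      ≤ ∫⁻ y : ℝ in Set.Ico (-R) 0 ∪ {0} ∪ Set.Ioc 0 R, ‖y‖ₑ ^ (-a) := lintegral_mono_set hsub
    _ ≤ _ := lintegral_union_le _ _ _
    _ ≤ _ := add_le_add_left (lintegral_union_le _ _ _) _
    _ < ∞ := by simp [h', h'']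

/-- Rotations preserve volume and map the cube into a larger one independent of `b`. This uniformity
matters because `b` will depend on the remaining columns. -/
theorem exists_lintegral_prod_enorm_inner_rpow_le (m : ℕ) {a : ℝ} (ha : a < 1) (R : ℝ) :
    ∃ K : ℝ≥0∞, K < ∞ ∧ ∀ (b : OrthonormalBasis (Fin m) ℝ (EuclideanSpace ℝ (Fin m)))
      (s : Finset (Fin m)),
      ∫⁻ x : Fin m → ℝ in Set.univ.pi fun _ => Set.Icc (-R) R,
        ∏ i ∈ s, ‖inner ℝ (b i) (WithLp.toLp 2 x)‖ₑ ^ (-a) ≤ K := by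
  -- The summand `1` makes every factor at least `1`, so the product over `s` extends to all
  -- coordinates.
  set g : ℝ → ℝ≥0∞ := fun y => 1 + ‖y‖ₑ ^ (-a) with hg
  have hgm : Measurable g := by fun_prop
  have hg1 : ∀ y, 1 ≤ g y := fun y => le_self_add
  set S : ℝ := √(m * R ^ 2)
  refine ⟨_, lintegral_pi_prod_lt_top (ι := Fin m) hgm
    (lintegral_Icc_one_add_enorm_rpow_lt_top ha S), fun b s => ?_⟩
  set T : (Fin m → ℝ) → (Fin m → ℝ) := fun x => WithLp.ofLp (b.repr (WithLp.toLp 2 x))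
  have hT : MeasurePreserving T :=
    (PiLp.volume_preserving_ofLp (Fin m)).comp
      (b.measurePreserving_repr.comp (PiLp.volume_preserving_toLp (Fin m)))
  have hTx : ∀ x i, T x i = inner ℝ (b i) (WithLp.toLp 2 x) := fun x i => b.repr_apply_apply _ i
  have hsub : (Set.univ.pi fun _ => Set.Icc (-R) R : Set (Fin m → ℝ)) ⊆
      T ⁻¹' (Set.univ.pi fun _ => Set.Icc (-S) S) := by
    intro x hx i _
    have hn : ‖(WithLp.toLp 2 x : EuclideanSpace ℝ (Fin m))‖ ≤ S := by
      rw [EuclideanSpace.norm_eq]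
      refine Real.sqrt_le_sqrt ?_
      calc ∑ i, ‖x i‖ ^ 2 ≤ ∑ i : Fin m, R ^ 2 := by
            refine Finset.sum_le_sum fun i _ => ?_
            have := hx i trivial
            simp only [Set.mem_Icc] at this
            exact pow_le_pow_left₀ (norm_nonneg _) (abs_le.2 this) 2
        _ = _ := by simp
    rw [hTx]
    have := abs_real_inner_le_norm (b i) (WithLp.toLp 2 x)
    rw [b.norm_eq_one, one_mul] at this
    exact abs_le.1 (this.trans hn)
  calc _ ≤ ∫⁻ x : Fin m → ℝ in T ⁻¹' (Set.univ.pi fun _ => Set.Icc (-S) S),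
        ∏ i ∈ s, ‖inner ℝ (b i) (WithLp.toLp 2 x)‖ₑ ^ (-a) := lintegral_mono_set hsub
    _ ≤ ∫⁻ x : Fin m → ℝ in T ⁻¹' (Set.univ.pi fun _ => Set.Icc (-S) S), ∏ i, g (T x i) := by
        refine lintegral_mono fun x => ?_
        calc _ ≤ ∏ i ∈ s, g (T x i) :=
              Finset.prod_le_prod' fun i _ => by rw [hTx]; exact le_add_self
          _ ≤ _ := Finset.prod_le_prod_of_subset_of_one_le' (Finset.subset_univ s)
              fun i _ _ => hg1 _
    _ = ∫⁻ x : Fin m → ℝ in (Set.univ.pi fun _ => Set.Icc (-S) S), ∏ i, g (x i) :=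
        hT.setLIntegral_comp_preimage (MeasurableSet.univ_pi fun _ => measurableSet_Icc)
          (f := fun x => ∏ i, g (x i)) (by fun_prop)
    _ = _ := by
        rw [volume_pi, Measure.restrict_pi_pi]

theorem exists_orthonormalBasis_inner_eq_zero {m k : ℕ} (w : Fin k → EuclideanSpace ℝ (Fin m)) :
    ∃ b : OrthonormalBasis (Fin m) ℝ (EuclideanSpace ℝ (Fin m)),
      ∀ i : Fin m, (i : ℕ) < m - k → ∀ l, inner ℝ (b i) (w l) = 0 := by
  set V := Submodule.span ℝ (Set.range w)
  have hV : Module.finrank ℝ V ≤ k := by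
    exact (finrank_range_le_card (R := ℝ) w).trans_eq (Fintype.card_fin k)
  have hsum := V.finrank_add_finrank_orthogonal
  rw [finrank_euclideanSpace_fin] at hsum
  set r := Module.finrank ℝ Vᗮ with hr
  have hlt : ∀ i : Fin m, (i : ℕ) < m - k → (i : ℕ) < r := fun i hi => by omega
  let c := stdOrthonormalBasis ℝ Vᗮ
  let v : Fin m → EuclideanSpace ℝ (Fin m) :=
    fun i => if h : (i : ℕ) < r then (c ⟨i, h⟩ : EuclideanSpace ℝ (Fin m)) else 0
  have hv : Orthonormal ℝ (Set.domRestrict {i : Fin m | (i : ℕ) < r} v) := by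
    have h1 := (c.orthonormal.comp_linearIsometry Vᗮ.subtypeₗᵢ).comp
      (fun i : {i : Fin m | (i : ℕ) < r} => (⟨i.1, i.2⟩ : Fin r))
      (fun i j h => by simpa [Subtype.ext_iff, Fin.ext_iff] using h)
    convert! h1 using 1
    funext i
    have := i.2
    simp only [Set.mem_ofPred_eq] at this
    simp [v, this]
  obtain ⟨b, hb⟩ := hv.exists_orthonormalBasis_extension_of_card_eq (by simp)
  refine ⟨b, fun i hi l => ?_⟩
  rw [hb i (hlt i hi)]
  simp only [v, hlt i hi, dif_pos]
  rw [real_inner_comm]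
  exact (Submodule.mem_orthogonal _ _).1 (c ⟨i, hlt i hi⟩).2 _ (Submodule.subset_span ⟨l, rfl⟩)

/-! ### Linear algebra of the inverse Gram matrix. -/

theorem gram_inv_diag_eq {m n : ℕ} (A : Matrix (Fin m) (Fin n) ℝ) (i j : Fin n)
    (h : IsUnit (Aᵀ * A)) :
    (Aᵀ * A)⁻¹ i j = (A *ᵥ (Aᵀ * A)⁻¹.col i) ⬝ᵥ (A *ᵥ (Aᵀ * A)⁻¹.col j) := by
  have hd := (Matrix.isUnit_iff_isUnit_det _).1 h
  have hs : ((Aᵀ * A)⁻¹)ᵀ = (Aᵀ * A)⁻¹ := by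
    rw [Matrix.transpose_nonsing_inv]; simp
  have : (Aᵀ * A)⁻¹ = ((A * (Aᵀ * A)⁻¹)ᵀ * (A * (Aᵀ * A)⁻¹)) := by
    rw [Matrix.transpose_mul, hs, Matrix.mul_assoc, ← Matrix.mul_assoc Aᵀ,
      Matrix.mul_nonsing_inv _ hd, Matrix.mul_one]
  conv_lhs => rw [this]
  rfl

theorem gram_inv_diag_nonneg {m n : ℕ} (A : Matrix (Fin m) (Fin n) ℝ) (j : Fin n) :
    0 ≤ (Aᵀ * A)⁻¹ j j := by
  by_cases h : IsUnit (Aᵀ * A)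
  · rw [gram_inv_diag_eq A j j h]
    exact Finset.sum_nonneg fun i _ => mul_self_nonneg _
  · rw [Matrix.nonsing_inv_apply_not_isUnit _ (by rwa [← Matrix.isUnit_iff_isUnit_det])]
    simp

/-- Cauchy–Schwarz for `u` and the `j`-th column `w` of `A * (Aᵀ * A)⁻¹`, whose squared length is
the diagonal entry. In the singular case the inverse is `0` by convention. -/
theorem gram_inv_diag_mul_sq_le_one {m n : ℕ} (A : Matrix (Fin m) (Fin n) ℝ) (j : Fin n)
    (u : Fin m → ℝ) (hu : u ⬝ᵥ u = 1) (hA : ∀ l, l ≠ j → u ⬝ᵥ A.col l = 0) :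
    (Aᵀ * A)⁻¹ j j * (u ⬝ᵥ A.col j) ^ 2 ≤ 1 := by
  by_cases h : IsUnit (Aᵀ * A)
  · set g := (Aᵀ * A)⁻¹ j j with hg
    set w := A *ᵥ (Aᵀ * A)⁻¹.col j
    have hw : w ⬝ᵥ w = g := (gram_inv_diag_eq A j j h).symm
    have huw : u ⬝ᵥ w = (u ⬝ᵥ A.col j) * g := by
      rw [Matrix.dotProduct_mulVec]
      exact Finset.sum_eq_single_of_mem j (Finset.mem_univ _) fun l _ hl => by
        have : (u ᵥ* A) l = 0 := hA l hl
        rw [this, zero_mul]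
    have hcs : (u ⬝ᵥ w) ^ 2 ≤ (u ⬝ᵥ u) * (w ⬝ᵥ w) := by
      simpa [dotProduct, sq] using Finset.sum_mul_sq_le_sq_mul_sq Finset.univ u w
    rw [huw, hu, hw, one_mul] at hcs
    have hg0 : 0 ≤ g := gram_inv_diag_nonneg A j
    rcases hg0.eq_or_lt with h0 | h0
    · simp [← h0]
    · refine le_of_mul_le_mul_right ?_ h0
      linarith
  · rw [Matrix.nonsing_inv_apply_not_isUnit _ (by rwa [← Matrix.isUnit_iff_isUnit_det])]
    simp

theorem frobNorm_eq {m n : ℕ} (M : Matrix (Fin m) (Fin n) ℝ) :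
    frobNorm M = √(∑ i, ∑ j, M i j ^ 2) := by
  unfold frobNorm
  rw [Matrix.frobenius_norm_def, Real.sqrt_eq_rpow]
  simp

theorem abs_le_frobNorm {m n : ℕ} (M : Matrix (Fin m) (Fin n) ℝ) (i : Fin m) (j : Fin n) :
    |M i j| ≤ frobNorm M := by
  rw [frobNorm_eq]
  refine Real.abs_le_sqrt ?_
  calc M i j ^ 2 ≤ ∑ j, M i j ^ 2 :=
        Finset.single_le_sum (f := fun j => M i j ^ 2) (fun _ _ => sq_nonneg _) (Finset.mem_univ j)
    _ ≤ _ := Finset.single_le_sum (f := fun i => ∑ j, M i j ^ 2)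
        (fun _ _ => Finset.sum_nonneg fun _ _ => sq_nonneg _) (Finset.mem_univ i)

theorem frobNorm_nonneg {m n : ℕ} (M : Matrix (Fin m) (Fin n) ℝ) : 0 ≤ frobNorm M := by
  rw [frobNorm_eq]; positivity

theorem frobNorm_mul_le {l m n : ℕ} (M : Matrix (Fin l) (Fin m) ℝ) (N : Matrix (Fin m) (Fin n) ℝ) :
    frobNorm (M * N) ≤ frobNorm M * frobNorm N :=
  Matrix.frobenius_norm_mul M N

theorem frobNorm_transpose {m n : ℕ} (M : Matrix (Fin m) (Fin n) ℝ) :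
    frobNorm Mᵀ = frobNorm M :=
  Matrix.frobenius_norm_transpose M

theorem frobNorm_gram_inv_le_trace {m n : ℕ} (A : Matrix (Fin m) (Fin n) ℝ) :
    frobNorm (Aᵀ * A)⁻¹ ≤ ∑ j, (Aᵀ * A)⁻¹ j j := by
  rw [frobNorm_eq]
  refine Real.sqrt_le_iff.2 ⟨Finset.sum_nonneg fun j _ => gram_inv_diag_nonneg A j, ?_⟩
  rw [sq, Finset.sum_mul_sum]
  refine Finset.sum_le_sum fun i _ => Finset.sum_le_sum fun j _ => ?_
  by_cases h : IsUnit (Aᵀ * A)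
  · rw [gram_inv_diag_eq A i j h, gram_inv_diag_eq A i i h, gram_inv_diag_eq A j j h]
    simpa [dotProduct, sq] using Finset.sum_mul_sq_le_sq_mul_sq Finset.univ
      (A *ᵥ (Aᵀ * A)⁻¹.col i) (A *ᵥ (Aᵀ * A)⁻¹.col j)
  · rw [Matrix.nonsing_inv_apply_not_isUnit _ (by rwa [← Matrix.isUnit_iff_isUnit_det])]
    simp

theorem one_le_frobNorm_gram_inv_mul {m n : ℕ} [NeZero n] (A : Matrix (Fin m) (Fin n) ℝ)
    (h : IsUnit (Aᵀ * A)) : 1 ≤ frobNorm A ^ 2 * frobNorm (Aᵀ * A)⁻¹ := by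
  have hd := (Matrix.isUnit_iff_isUnit_det _).1 h
  calc (1 : ℝ) = |(1 : Matrix (Fin n) (Fin n) ℝ) 0 0| := by simp
    _ ≤ frobNorm (1 : Matrix (Fin n) (Fin n) ℝ) := abs_le_frobNorm _ _ _
    _ = frobNorm ((Aᵀ * A) * (Aᵀ * A)⁻¹) := by rw [Matrix.mul_nonsing_inv _ hd]
    _ ≤ frobNorm (Aᵀ * A) * frobNorm (Aᵀ * A)⁻¹ := frobNorm_mul_le _ _
    _ ≤ (frobNorm Aᵀ * frobNorm A) * frobNorm (Aᵀ * A)⁻¹ :=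
        mul_le_mul_of_nonneg_right (frobNorm_mul_le _ _) (frobNorm_nonneg _)
    _ = _ := by rw [frobNorm_transpose, sq]

/-! ### Measurability and almost sure invertibility. -/

instance matrixBorelSpace (m n : ℕ) : BorelSpace (Matrix (Fin m) (Fin n) ℝ) :=
  inferInstanceAs (BorelSpace (Fin m → Fin n → ℝ))

theorem measurable_gram_inv_apply (m n : ℕ) (i j : Fin n) :
    Measurable fun A : Matrix (Fin m) (Fin n) ℝ => (Aᵀ * A)⁻¹ i j := by
  have h1 : Continuous fun A : Matrix (Fin m) (Fin n) ℝ => (Aᵀ * A).det := by fun_prop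
  have h2 : Continuous fun A : Matrix (Fin m) (Fin n) ℝ => (Aᵀ * A).adjugate i j :=
    (Continuous.matrix_adjugate (by fun_prop)).matrix_elem i j
  simp only [Matrix.inv_def, Ring.inverse_eq_inv', Matrix.smul_apply, smul_eq_mul]
  exact h1.measurable.inv.mul h2.measurable

theorem measurable_frobNorm_gram_inv (m n : ℕ) :
    Measurable fun A : Matrix (Fin m) (Fin n) ℝ => frobNorm (Aᵀ * A)⁻¹ := by
  simp only [frobNorm_eq]
  exact (Finset.measurable_fun_sum _ fun i _ => Finset.measurable_fun_sum _ fun j _ =>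
    (measurable_gram_inv_apply m n i j).pow_const 2).sqrt

theorem isUnit_gram_of_submatrix {m n : ℕ} (A : Matrix (Fin m) (Fin n) ℝ) (e : Fin n → Fin m)
    (h : (A.submatrix e id).det ≠ 0) : IsUnit (Aᵀ * A) := by
  rw [← Matrix.mulVec_injective_iff_isUnit, ← Matrix.coe_mulVecLin, ← LinearMap.ker_eq_bot]
  have := Matrix.ker_mulVecLin_conjTranspose_mul_self A
  rw [Matrix.conjTranspose_eq_transpose_of_trivial] at this
  rw [this, LinearMap.ker_eq_bot']
  intro v hv
  refine Matrix.eq_zero_of_mulVec_eq_zero h ?_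
  funext i
  exact congrFun hv (e i)

theorem ae_isUnit_gram {m n : ℕ} (hmn : n ≤ m) :
    ∀ᵐ A : Matrix (Fin m) (Fin n) ℝ, IsUnit (Aᵀ * A) := by
  set e : Fin n → Fin m := Fin.castLE hmn with he
  have hdet : Continuous fun A : Fin m → Fin n → ℝ => ((Matrix.of A).submatrix e id).det := by
    refine Continuous.matrix_det ?_
    exact continuous_matrix fun i j => by simp only [Matrix.submatrix_apply, Matrix.of_apply]; fun_prop
  set E : Fin m → Fin n → ℝ := fun i j => if i = e j then 1 else 0 with hE
  have key : ∀ᵐ A : Fin m → Fin n → ℝ,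
      A ∈ {A : Fin m → Fin n → ℝ | ((Matrix.of A).submatrix e id).det ≠ 0} := by
    -- Fubini along lines in direction `E`: the top minor of `A + t • E` is the characteristic
    -- polynomial of `-B` at `t`, which has finitely many roots.
    refine ae_mem_of_ae_add_linearMap_mem
      (LinearMap.toSpanSingleton ℝ (Fin m → Fin n → ℝ) E) volume volume
      (hdet.measurable (measurableSet_singleton 0).compl) fun A => ?_
    set B := (Matrix.of A).submatrix e id
    have hfin : {t : ℝ | (-B).charpoly.eval t = 0}.Finite := by
      refine ((-B).charpoly.roots.toFinset.finite_toSet).subset fun t ht => ?_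
      simpa [(-B).charpoly_monic.ne_zero] using ht
    have hnull : ∀ᵐ t : ℝ, t ∉ {t : ℝ | (-B).charpoly.eval t = 0} :=
      measure_eq_zero_iff_ae_notMem.1 (hfin.measure_zero _)
    filter_upwards [hnull] with t ht
    change ¬ (-B).charpoly.eval t = 0 at ht
    rw [Matrix.eval_charpoly] at ht
    change ((Matrix.of (A + t • E)).submatrix e id).det ≠ 0
    convert ht using 2
    ext i j
    have : (e i = e j) ↔ i = j := (Fin.castLE_injective hmn).eq_iff
    simp [B, hE, Matrix.scalar_apply, Matrix.diagonal_apply, this, add_comm]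
  have key' : ∀ᵐ A : Matrix (Fin m) (Fin n) ℝ, (A.submatrix e id).det ≠ 0 := key
  exact key'.mono fun A hA => isUnit_gram_of_submatrix A e hA

/-! ### Integration over one column with the others frozen. -/

theorem volume_preserving_splitColumn (m k : ℕ) (j : Fin (k + 1)) :
    MeasurePreserving (fun A : Matrix (Fin m) (Fin (k + 1)) ℝ =>
      ((fun i => A i j, fun i l => A i (j.succAbove l)) : (Fin m → ℝ) × (Fin m → Fin k → ℝ))) := by
  have h1 : MeasurePreserving (fun (A : Fin m → Fin (k + 1) → ℝ) (i : Fin m) =>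
      MeasurableEquiv.piFinSuccAbove (fun _ => ℝ) j (A i)) :=
    volume_preserving_pi fun _ => volume_preserving_piFinSuccAbove (fun _ => ℝ) j
  exact (volume_measurePreserving_arrowProdEquivProdArrow ℝ (Fin k → ℝ) (Fin m)).comp h1

theorem ENNReal.ofReal_le_enorm_rpow_neg {g y : ℝ} (h : g * y ^ 2 ≤ 1) :
    ENNReal.ofReal g ≤ ‖y‖ₑ ^ (-2 : ℝ) := by
  rcases eq_or_ne y 0 with rfl | hy
  · simp
  · have hy' : 0 < |y| := abs_pos.2 hy
    rw [← ofReal_norm, Real.norm_eq_abs, ENNReal.ofReal_rpow_of_pos hy']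
    refine ENNReal.ofReal_le_ofReal ?_
    rw [Real.rpow_neg hy'.le, Real.rpow_two, sq_abs, ← one_div, le_div_iff₀ (by positivity)]
    exact h

theorem lintegral_gram_inv_diag_rpow_lt_top {m k : ℕ} (hk : k + 1 ≤ m) {p : ℝ} (hp : 0 ≤ p)
    (hpm : p < ((m : ℝ) - k) / 2) (R : ℝ) (j : Fin (k + 1)) :
    ∫⁻ A : Matrix (Fin m) (Fin (k + 1)) ℝ in {A | ∀ i l, |A i l| ≤ R},
      ENNReal.ofReal ((Aᵀ * A)⁻¹ j j) ^ p < ∞ := by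
  set d : ℕ := m - k with hd
  have hdm : (d : ℝ) = m - k := by rw [hd, Nat.cast_sub (by omega)]
  have hd0 : (0 : ℝ) < d := by rw [hd]; exact_mod_cast (by omega)
  -- The power `p` is shared equally among `d` factors, each bounded by an inverse square.
  set a : ℝ := 2 * p / d with ha
  have ha1 : a < 1 := by rw [ha, div_lt_one hd0, hdm]; linarith
  obtain ⟨K, hK, hKb⟩ := exists_lintegral_prod_enorm_inner_rpow_le m ha1 R
  set Q : Set (Fin m → ℝ) := Set.univ.pi fun _ => Set.Icc (-R) R with hQ
  set Q' : Set (Fin m → Fin k → ℝ) := Set.univ.pi fun _ => Set.univ.pi fun _ => Set.Icc (-R) R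
    with hQ'
  have hQm : MeasurableSet Q := MeasurableSet.univ_pi fun _ => measurableSet_Icc
  have hQm' : MeasurableSet Q' :=
    MeasurableSet.univ_pi fun _ => MeasurableSet.univ_pi fun _ => measurableSet_Icc
  set J : (Fin m → ℝ) × (Fin m → Fin k → ℝ) → Matrix (Fin m) (Fin (k + 1)) ℝ :=
    fun z => Matrix.of fun i => j.insertNth (α := fun _ => ℝ) (z.1 i) (z.2 i) with hJ
  have hJj : ∀ z i, J z i j = z.1 i := fun z i => by simp [hJ]
  have hJl : ∀ z i l, J z i (j.succAbove l) = z.2 i l := fun z i l => by simp [hJ]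
  have hJm : Measurable J := by
    refine measurable_pi_iff.2 fun i => measurable_pi_iff.2 fun l => ?_
    induction l using j.succAboveCases with
    | x => simp only [hJj]; exact (measurable_pi_apply i).comp measurable_fst
    | p l =>
      simp only [hJl]
      exact (measurable_pi_apply l).comp ((measurable_pi_apply i).comp measurable_snd)
  set f : Matrix (Fin m) (Fin (k + 1)) ℝ → ℝ≥0∞ :=
    fun A => ENNReal.ofReal ((Aᵀ * A)⁻¹ j j) ^ p with hf
  have hfm : Measurable f := (measurable_gram_inv_apply m _ j j).ennreal_ofReal.pow_const p
  have hsplit := volume_preserving_splitColumn m k j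
  have hset : {A : Matrix (Fin m) (Fin (k + 1)) ℝ | ∀ i l, |A i l| ≤ R} =
      (fun A : Matrix (Fin m) (Fin (k + 1)) ℝ =>
        ((fun i => A i j, fun i l => A i (j.succAbove l)) :
          (Fin m → ℝ) × (Fin m → Fin k → ℝ))) ⁻¹' (Q ×ˢ Q') := by
    ext A
    simp only [Set.mem_ofPred_eq, hQ, hQ', Set.mem_preimage, Set.mem_prod, Set.mem_univ_pi,
      Set.mem_Icc, ← abs_le, j.forall_iff_succAbove, forall_and]
  have hcomp := hsplit.setLIntegral_comp_preimage (hQm.prod hQm') (hfm.comp hJm)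
  rw [hset]
  have hJs : ∀ A : Matrix (Fin m) (Fin (k + 1)) ℝ,
      J (fun i => A i j, fun i l => A i (j.succAbove l)) = A := by
    intro A
    ext i l
    induction l using j.succAboveCases with
    | x => rw [hJj]
    | p l => rw [hJl]
  simp only [Function.comp_def, hJs] at hcomp
  rw [hcomp, Measure.volume_eq_prod, ← Measure.prod_restrict,
    lintegral_prod_symm' (fun z => f (J z)) (hfm.comp hJm)]
  have hinner : ∀ B : Fin m → Fin k → ℝ, ∫⁻ x in Q, f (J (x, B)) ≤ K := by
    intro B
    obtain ⟨b, hb⟩ := exists_orthonormalBasis_inner_eq_zero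
      (fun l => (WithLp.toLp 2 fun i => B i l : EuclideanSpace ℝ (Fin m)))
    set s : Finset (Fin m) := Finset.univ.filter fun i => (i : ℕ) < d with hs
    have hcard : s.card = d := by
      rw [hs, Fin.card_filter_val_lt]; omega
    refine le_trans (lintegral_mono fun x => ?_) (hKb b s)
    set G : ℝ≥0∞ := ENNReal.ofReal (((J (x, B))ᵀ * J (x, B))⁻¹ j j) with hG
    have hGi : ∀ i ∈ s, G ≤ ‖inner ℝ (b i) (WithLp.toLp 2 x)‖ₑ ^ (-2 : ℝ) := by
      intro i hi
      refine ENNReal.ofReal_le_enorm_rpow_neg ?_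
      have hdot : ∀ y : Fin m → ℝ, (b i).ofLp ⬝ᵥ y = inner ℝ (b i) (WithLp.toLp 2 y) := by
        intro y
        simp [PiLp.inner_apply, dotProduct, mul_comm]
      have := gram_inv_diag_mul_sq_le_one (J (x, B)) j (b i).ofLp ?_ ?_
      · rw [hdot] at this
        convert this using 5
        funext i
        exact (hJj (x, B) _).symm
      · rw [hdot]
        simp
      · intro l hl
        obtain ⟨l, rfl⟩ := Fin.exists_succAbove_eq hl
        rw [hdot]
        convert hb i (by simpa [hs] using hi) l using 3
        funext i
        exact hJl (x, B) _ _
    calc f (J (x, B)) = ∏ i ∈ s, G ^ (p / d) := by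
          rw [Finset.prod_const, hcard, ← ENNReal.rpow_mul_natCast, div_mul_cancel₀ _ hd0.ne']
      _ ≤ ∏ i ∈ s, (‖inner ℝ (b i) (WithLp.toLp 2 x)‖ₑ ^ (-2 : ℝ)) ^ (p / d) :=
          Finset.prod_le_prod' fun i hi =>
            ENNReal.rpow_le_rpow (hGi i hi) (by positivity)
      _ = _ := by
          refine Finset.prod_congr rfl fun i _ => ?_
          rw [← ENNReal.rpow_mul, ha]
          congr 1
          ring
  calc _ ≤ ∫⁻ _ in Q', K := lintegral_mono fun B => hinner B
    _ = K * volume Q' := by simp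
    _ < ∞ := by
      refine ENNReal.mul_lt_top hK ?_
      rw [hQ', volume_pi_pi]
      refine ENNReal.prod_lt_top fun i _ => ?_
      rw [volume_pi_pi]
      exact ENNReal.prod_lt_top fun i _ => by simp

/-! ### From diagonal entries to the moment. -/

/-- Comparison with the largest term needs no convexity, so `p < 1` is covered. -/
theorem ENNReal.sum_rpow_le {ι : Type*} (s : Finset ι) (x : ι → ℝ≥0∞) {p : ℝ} (hp : 0 < p) :
    (∑ i ∈ s, x i) ^ p ≤ (s.card : ℝ≥0∞) ^ p * ∑ i ∈ s, x i ^ p := by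
  rcases s.eq_empty_or_nonempty with rfl | hs
  · simp [hp]
  obtain ⟨j, hj, hmax⟩ := s.exists_max_image x hs
  calc (∑ i ∈ s, x i) ^ p ≤ (s.card * x j) ^ p := by
        refine ENNReal.rpow_le_rpow ?_ hp.le
        simpa using Finset.sum_le_card_nsmul s x (x j) hmax
    _ = (s.card : ℝ≥0∞) ^ p * x j ^ p := ENNReal.mul_rpow_of_nonneg _ _ hp.le
    _ ≤ _ := mul_le_mul_right (Finset.single_le_sum (f := fun i => x i ^ p) (fun _ _ => zero_le) hj) _

theorem lintegral_frobNorm_gram_inv_rpow_lt_top {m n : ℕ} (hmn : n ≤ m) {p : ℝ} (hp : 0 < p)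
    (hpm : p < ((m : ℝ) - n + 1) / 2) (R : ℝ) :
    ∫⁻ A : Matrix (Fin m) (Fin n) ℝ in {A | ∀ i l, |A i l| ≤ R},
      ENNReal.ofReal (frobNorm (Aᵀ * A)⁻¹) ^ p < ∞ := by
  calc _ ≤ ∫⁻ A : Matrix (Fin m) (Fin n) ℝ in {A | ∀ i l, |A i l| ≤ R},
        ((Finset.univ : Finset (Fin n)).card : ℝ≥0∞) ^ p *
          ∑ j, ENNReal.ofReal ((Aᵀ * A)⁻¹ j j) ^ p := by
        refine lintegral_mono fun A => ?_
        refine le_trans ?_ (ENNReal.sum_rpow_le _ _ hp)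
        rw [← ENNReal.ofReal_sum_of_nonneg fun j _ => gram_inv_diag_nonneg A j]
        exact ENNReal.rpow_le_rpow
          (ENNReal.ofReal_le_ofReal (frobNorm_gram_inv_le_trace A)) hp.le
    _ < ∞ := by
        have hm : ∀ j, Measurable fun A : Matrix (Fin m) (Fin n) ℝ =>
            ENNReal.ofReal ((Aᵀ * A)⁻¹ j j) ^ p := fun j =>
          (measurable_gram_inv_apply m n j j).ennreal_ofReal.pow_const p
        rw [lintegral_const_mul _ (Finset.measurable_fun_sum _ fun j _ => hm j),
          lintegral_finsetSum _ fun j _ => hm j]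
        refine ENNReal.mul_lt_top
          (ENNReal.rpow_lt_top_of_nonneg hp.le (ENNReal.natCast_ne_top _)) ?_
        refine ENNReal.sum_lt_top.2 fun j _ => ?_
        cases n with
        | zero => exact j.elim0
        | succ k =>
          refine lintegral_gram_inv_diag_rpow_lt_top hmn hp.le ?_ R j
          push_cast at hpm
          linarith

theorem map_le_essSup_pdf_smul {Ω E : Type*} [MeasurableSpace Ω] [MeasurableSpace E]
    (P : Measure Ω) (μ : Measure E) (X : Ω → E) [HasPDF X P μ] :
    P.map X ≤ essSup (pdf X P μ) μ • μ := by
  rw [map_eq_withDensity_pdf X P μ, ← withDensity_const]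
  exact withDensity_mono (ENNReal.ae_le_essSup _)

theorem mainTheorem5 {Ω : Type*} [MeasurableSpace Ω] (P : Measure Ω) [IsProbabilityMeasure P]
    (m n : ℕ) (hmn : n ≤ m) (A : Ω → Matrix (Fin m) (Fin n) ℝ)
    (hbdd : ∃ C : ℝ, P {ω | frobNorm (A ω) > C} = 0)
    (hpdf : HasPDF A P volume)
    (hsup : essSup (pdf A P volume) volume < ∞) :
    (∀ᵐ ω ∂P, IsUnit ((A ω)ᵀ * A ω)) ∧
      ∀ p : ℝ, p < ((m : ℝ) - (n : ℝ) + 1) / 2 →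
        HasFiniteMoment (fun ω => ((A ω)ᵀ * A ω)⁻¹) p P := by
  have hA : AEMeasurable A P := HasPDF.aemeasurable A P volume
  have hunit : ∀ᵐ ω ∂P, IsUnit ((A ω)ᵀ * A ω) :=
    ae_of_ae_map hA ((HasPDF.absolutelyContinuous : P.map A ≪ volume).ae_le (ae_isUnit_gram hmn))
  refine ⟨hunit, fun p hp => ?_⟩
  obtain ⟨C, hC⟩ := hbdd
  have hbd : ∀ᵐ ω ∂P, frobNorm (A ω) ≤ C := by
    filter_upwards [measure_eq_zero_iff_ae_notMem.1 hC] with ω hω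
    exact not_lt.1 hω
  have hmeas : AEMeasurable (fun ω => frobNorm ((A ω)ᵀ * A ω)⁻¹ ^ p) P :=
    ((measurable_frobNorm_gram_inv m n).pow_const p).comp_aemeasurable hA
  unfold HasFiniteMoment
  rcases le_or_gt p 0 with hp0 | hp0
  · rcases Nat.eq_zero_or_pos n with rfl | hn
    · simp only [Subsingleton.elim _ (0 : Matrix (Fin 0) (Fin 0) ℝ)]
      exact integrable_const _
    · have : NeZero n := ⟨hn.ne'⟩
      -- `1 ≤ ‖A‖ ^ 2 * ‖G⁻¹‖` gives `‖G⁻¹‖ ≥ (C ^ 2)⁻¹`, and a nonpositive power reverses the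
      -- inequality.
      refine Integrable.of_bound hmeas.aestronglyMeasurable ((C ^ 2)⁻¹ ^ p) ?_
      filter_upwards [hbd, hunit] with ω hω hu
      have h1 := one_le_frobNorm_gram_inv_mul (A ω) hu
      have h0 := frobNorm_nonneg (A ω)
      have h2 := frobNorm_nonneg ((A ω)ᵀ * A ω)⁻¹
      have h3 : 1 ≤ C ^ 2 * frobNorm ((A ω)ᵀ * A ω)⁻¹ :=
        h1.trans (mul_le_mul_of_nonneg_right (pow_le_pow_left₀ h0 hω 2) h2)
      have hC2 : 0 < C ^ 2 := by
        refine (sq_nonneg C).lt_of_ne fun h => ?_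
        rw [← h, zero_mul] at h3
        exact absurd h3 (by norm_num)
      rw [Real.norm_of_nonneg (Real.rpow_nonneg h2 p)]
      refine Real.rpow_le_rpow_of_nonpos (inv_pos.2 hC2) ?_ hp0
      exact (inv_le_iff_one_le_mul₀' hC2).2 h3
  · refine ⟨hmeas.aestronglyMeasurable, ?_⟩
    rw [hasFiniteIntegral_iff_enorm]
    set f : Matrix (Fin m) (Fin n) ℝ → ℝ≥0∞ :=
      fun M => ENNReal.ofReal (frobNorm (Mᵀ * M)⁻¹) ^ p
    have hf : Measurable f := (measurable_frobNorm_gram_inv m n).ennreal_ofReal.pow_const p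
    set S : Set (Matrix (Fin m) (Fin n) ℝ) := {M | ∀ i l, |M i l| ≤ C} with hS
    have hSm : MeasurableSet S := by
      have hc : IsClosed S := by
        simp only [hS, Set.ofPred_forall]
        exact isClosed_iInter fun i => isClosed_iInter fun l =>
          isClosed_le (continuous_id.matrix_elem i l).abs continuous_const
      exact hc.measurableSet
    have hAS : ∀ᵐ M ∂(P.map A), M ∈ S := by
      refine (ae_map_iff hA hSm).2 ?_
      filter_upwards [hbd] with ω hω i l
      exact (abs_le_frobNorm _ i l).trans hω
    calc ∫⁻ ω, ‖frobNorm ((A ω)ᵀ * A ω)⁻¹ ^ p‖ₑ ∂P = ∫⁻ ω, f (A ω) ∂P := by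
          refine lintegral_congr fun ω => ?_
          rw [Real.enorm_of_nonneg (Real.rpow_nonneg (frobNorm_nonneg _) p),
            ← ENNReal.ofReal_rpow_of_nonneg (frobNorm_nonneg _) hp0.le]
      _ = ∫⁻ M, f M ∂(P.map A) := (lintegral_map' hf.aemeasurable hA).symm
      _ = ∫⁻ M in S, f M ∂(P.map A) := by rw [Measure.restrict_eq_self_of_ae_mem hAS]
      _ ≤ ∫⁻ M in S, f M ∂(essSup (pdf A P volume) volume • volume) :=
          lintegral_mono' (Measure.restrict_mono le_rfl (map_le_essSup_pdf_smul P volume A)) le_rfl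
      _ = essSup (pdf A P volume) volume * ∫⁻ M in S, f M := by
          rw [Measure.restrict_smul, lintegral_smul_measure, smul_eq_mul]
      _ < ∞ := ENNReal.mul_lt_top hsup
          (lintegral_frobNorm_gram_inv_rpow_lt_top hmn hp0 hp C)
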